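/- Let $\Theta=(\theta_{jk})$ be a real skew-symmetric $4\times4$ matrix and let $A_\Theta$ be the noncommutative $4$-torus, i.e. the universal unital $C^*$-algebra generated by unitaries $U_1,\dots,U_4$ with $U_jU_k=e^{2\pi i\theta_{jk}}U_kU_j$. Let $\alpha$ be the action of $\mathbb R^4$ on $A_\Theta$ with $\alpha_s(U_j)=e^{is_j}U_j$, let $A_\Theta^\infty$ be its algebra of smooth vectors, let $\partial_1,\dots,\partial_4$ be the canonical derivations of $A_\Theta^\infty$, with $\partial_jU_k=2\pi i\,\delta_{jk}U_k$, and let $\tau$ be the canonical trace ($\tau(1)=1$ and $\tau(U_1^{k_1}\cdots U_4^{k_4})=0$ for $0\neq k\in\mathbb Z^4$). For $f=f^*\in A_\Theta^\infty$ let $$\Omega(f)=\frac32\sum_{i=1}^4\tau\big((\partial_ie^f)\,e^{-f}\,(\partial_ie^f)\big)$$ be the Einstein–Hilbert action of the conformally flat metric $e^f\delta_{ij}$. A gradient of $\Omega$ at $f$ is an element $G\in A_\Theta^\infty$ such that for all $h=h^*\in A_\Theta^\infty$ the derivative $\frac{d}{dt}\big|_{t=0}\Omega(f+th)$ exists and equals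 $\tau(hG)$. For $g\in A_\Theta$ let $\nabla_g(x)=gx-xg$, which is the logarithm of the modular operator $x\mapsto e^gxe^{-g}$, and for a bounded operator $T$ let $\frac{e^{-T}-1}{T}=\sum_{k\ge0}\frac{(-1)^{k+1}}{(k+1)!}T^k$. Then for every $f=f^*\in A_\Theta^\infty$ there is exactly one gradient of $\Omega$ at $f$, and it is $$\mathrm{Grad}_f\Omega=\frac32\sum_{i=1}^4\Big\{e^{f}\,\frac{e^{-\nabla_f}-1}{\nabla_f}\big(\partial_i(e^{-f}\,\partial_ie^f)\big)+e^{-f}\,\frac{e^{-\nabla_{-f}}-1}{\nabla_{-f}}\big((\partial_ie^f)(\partial_ie^f)\big)+e^{f}\,\frac{e^{-\nabla_f}-1}{\nabla_f}\big(\partial_i((\partial_ie^f)\,e^{-f})\big)\Big\}.$$ -/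

import Mathlib

namespace NCTorus

open scoped ContDiff

noncomputable section

/-- Real skew-symmetric `n × n` matrices. -/
abbrev SkewMatrix (n : ℕ) : Type := {Θ : Matrix (Fin n) (Fin n) ℝ // Θ.transpose = -Θ}

/-- The Hilbert space `ℓ²(ℤⁿ)`. -/
abbrev HSpace (n : ℕ) : Type := lp (fun _ : Fin n → ℤ => ℂ) 2

/-- An `n`-tuple of unitaries `V₁, …, Vₙ` on `ℓ²(ℤⁿ)` with
`V_j V_k = e^{2πi θ_{jk}} V_k V_j`. -/
structure Rep {n : ℕ} (Θ : SkewMatrix n) where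
  V : Fin n → (HSpace n →L[ℂ] HSpace n)
  mem_unitary : ∀ j, V j ∈ unitary (HSpace n →L[ℂ] HSpace n)
  comm_rel : ∀ j k,
    V j * V k = Complex.exp (2 * Real.pi * Complex.I * (Θ.1 j k : ℂ)) • (V k * V j)

/-- The set of all representations is regarded as a discrete space, so that all functions on it
are continuous. -/
instance {n : ℕ} (Θ : SkewMatrix n) : TopologicalSpace (Rep Θ) := ⊥

instance {n : ℕ} (Θ : SkewMatrix n) : DiscreteTopology (Rep Θ) := ⟨rfl⟩

/-- The C⋆-algebra of all bounded operator-valued functions on the set of representations, with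
pointwise operations and the supremum norm. -/
abbrev Ambient {n : ℕ} (Θ : SkewMatrix n) : Type :=
  BoundedContinuousFunction (Rep Θ) (HSpace n →L[ℂ] HSpace n)

instance {n : ℕ} (Θ : SkewMatrix n) : CStarAlgebra (Ambient Θ) := inferInstance

instance {n : ℕ} (Θ : SkewMatrix n) : IsTopologicalRing (Ambient Θ) :=
  NonUnitalSeminormedRing.toIsTopologicalRing

theorem norm_le_one_of_unitary {n : ℕ} {u : HSpace n →L[ℂ] HSpace n}
    (hu : u ∈ unitary (HSpace n →L[ℂ] HSpace n)) : ‖u‖ ≤ 1 :=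
  ContinuousLinearMap.opNorm_le_bound _ zero_le_one fun x => by
    rw [one_mul]; exact (Unitary.norm_map ⟨u, hu⟩ x).le

/-- The generator `U_j`, as the function `ρ ↦ V_j(ρ)`. -/
def ambientGen {n : ℕ} (Θ : SkewMatrix n) (j : Fin n) : Ambient Θ :=
  BoundedContinuousFunction.ofNormedAddCommGroupDiscrete (fun ρ : Rep Θ => ρ.V j) 1
    (fun ρ => norm_le_one_of_unitary (ρ.mem_unitary j))

/-- The noncommutative torus as a closed star subalgebra of the ambient C⋆-algebra. -/
def torusSubalgebra {n : ℕ} (Θ : SkewMatrix n) : StarSubalgebra ℂ (Ambient Θ) :=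
  (StarAlgebra.adjoin ℂ (Set.range (ambientGen Θ))).topologicalClosure

/-- The noncommutative `n`-torus `A_Θ`: the universal unital C⋆-algebra generated by unitaries
`U₁, …, Uₙ` with `U_j U_k = e^{2πi θ_{jk}} U_k U_j`. It is the completion of the star algebra
generated by the `U_j` in the norm `‖p(U)‖ = sup ‖p(V)‖` over all tuples `V` of unitaries that
satisfy these relations. A C⋆-algebra generated by such a tuple is separable, so that it is enough
to take the supremum over tuples of operators on the separable Hilbert space `ℓ²(ℤⁿ)`. -/
def Torus {n : ℕ} (Θ : SkewMatrix n) : Type := torusSubalgebra Θ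

instance {n : ℕ} (Θ : SkewMatrix n) : CStarAlgebra (Torus Θ) :=
  @StarSubalgebra.cstarAlgebra (StarSubalgebra ℂ (Ambient Θ)) (Ambient Θ) _ _ _ _ _
    (torusSubalgebra Θ) (StarSubalgebra.isClosed_topologicalClosure _)

/-- The generator `U_j` of `A_Θ`. -/
def U {n : ℕ} (Θ : SkewMatrix n) (j : Fin n) : Torus Θ :=
  ⟨ambientGen Θ j, StarSubalgebra.le_topologicalClosure _
    (StarAlgebra.subset_adjoin ℂ _ ⟨j, rfl⟩)⟩

/-! ### The action of `ℝⁿ` -/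

/-- Rotation of a tuple of unitaries: `V_j ↦ e^{i s_j} V_j`. -/
def Rep.rotate {n : ℕ} {Θ : SkewMatrix n} (s : Fin n → ℝ) (ρ : Rep Θ) : Rep Θ where
  V j := Complex.exp (Complex.I * (s j : ℂ)) • ρ.V j
  mem_unitary j := by
    have h := Unitary.mem_iff.1 (ρ.mem_unitary j)
    have h1 : (starRingEnd ℂ) (Complex.exp (Complex.I * (s j : ℂ)))
        * Complex.exp (Complex.I * (s j : ℂ)) = 1 := by
      rw [← Complex.exp_conj, ← Complex.exp_add]
      simp
    rw [Unitary.mem_iff, star_smul, smul_mul_smul_comm, smul_mul_smul_comm, h.1, h.2,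
      ← starRingEnd_apply, h1, mul_comm, h1]
    simp
  comm_rel j k := by
    rw [smul_mul_smul_comm, smul_mul_smul_comm, ρ.comm_rel j k, smul_smul, smul_smul]
    congr 1
    ring

/-- The action on the ambient algebra, `a ↦ (ρ ↦ a (rotate s ρ))`. -/
def ambientAction {n : ℕ} (Θ : SkewMatrix n) (s : Fin n → ℝ) : Ambient Θ →⋆ₐ[ℂ] Ambient Θ where
  toFun a := a.compContinuous ⟨Rep.rotate s, continuous_of_discreteTopology⟩
  map_one' := rfl
  map_mul' _ _ := rfl
  map_zero' := rfl
  map_add' _ _ := rfl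
  commutes' _ := rfl
  map_star' _ := rfl

theorem ambientAction_gen {n : ℕ} (Θ : SkewMatrix n) (s : Fin n → ℝ) (j : Fin n) :
    ambientAction Θ s (ambientGen Θ j) = Complex.exp (Complex.I * (s j : ℂ)) • ambientGen Θ j :=
  rfl

theorem ambientAction_mem {n : ℕ} (Θ : SkewMatrix n) (s : Fin n → ℝ) {a : Ambient Θ}
    (ha : a ∈ torusSubalgebra Θ) : ambientAction Θ s a ∈ torusSubalgebra Θ := by
  have hle : torusSubalgebra Θ ≤ (torusSubalgebra Θ).comap (ambientAction Θ s) := by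
    refine StarSubalgebra.topologicalClosure_minimal (StarAlgebra.adjoin_le ?_) ?_
    · rintro _ ⟨j, rfl⟩
      change ambientAction Θ s (ambientGen Θ j) ∈ torusSubalgebra Θ
      rw [ambientAction_gen]
      exact (torusSubalgebra Θ).smul_mem (U Θ j).2 _
    · exact (StarSubalgebra.isClosed_topologicalClosure _).preimage
        (BoundedContinuousFunction.continuous_compContinuous _)
  exact hle ha

/-- The action `α_s` of `s ∈ ℝⁿ` on `A_Θ`; it maps `U_j` to `e^{i s_j} U_j`. -/
def action {n : ℕ} (Θ : SkewMatrix n) (s : Fin n → ℝ) : Torus Θ →⋆ₐ[ℂ] Torus Θ :=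
  StarAlgHom.codRestrict ((ambientAction Θ s).comp (torusSubalgebra Θ).subtype) (torusSubalgebra Θ)
    (fun a => ambientAction_mem Θ s a.2)

/-- `a ∈ A_Θ^∞`: the orbit map `s ↦ α_s(a)` is smooth. -/
def IsSmooth {n : ℕ} {Θ : SkewMatrix n} (a : Torus Θ) : Prop :=
  ContDiff ℝ ∞ (fun s : Fin n → ℝ => action Θ s a)

/-- The canonical derivation `∂_j`, the generator of the `j`-th coordinate of the action, normalized
by `∂_j U_k = 2πi δ_{jk} U_k`. It is used on smooth elements only. -/
def del {n : ℕ} {Θ : SkewMatrix n} (j : Fin n) (a : Torus Θ) : Torus Θ :=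
  deriv (fun t : ℝ => action Θ (Pi.single j (2 * Real.pi * t)) a) 0

/-! ### The canonical trace -/

/-- The unitary `(W ξ)(m) = c(m) ξ(σ m)` of `ℓ²(ℤⁿ)`, for a permutation `σ` of `ℤⁿ` and
a function `c` into the unit circle. -/
def weightedPerm {n : ℕ} (σ : Equiv.Perm (Fin n → ℤ)) (c : (Fin n → ℤ) → Circle) :
    HSpace n ≃ₗᵢ[ℂ] HSpace n where
  toFun ξ := ⟨fun m => (c m : ℂ) * ξ (σ m), by
    have h := (memℓp_gen_iff (p := 2) (by norm_num)).1 ξ.2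
    refine (memℓp_gen_iff (p := 2) (by norm_num)).2 ?_
    simpa only [norm_mul, Circle.norm_coe, one_mul, Function.comp_def]
      using (σ.summable_iff).2 h⟩
  invFun ξ := ⟨fun m => ((c (σ.symm m))⁻¹ : ℂ) * ξ (σ.symm m), by
    have h := (memℓp_gen_iff (p := 2) (by norm_num)).1 ξ.2
    refine (memℓp_gen_iff (p := 2) (by norm_num)).2 ?_
    simpa only [norm_mul, norm_inv, Circle.norm_coe, inv_one, one_mul,
      Function.comp_def]
      using (σ.symm.summable_iff).2 h⟩
  left_inv ξ := by
    ext m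
    simp
  right_inv ξ := by
    ext m
    simp
  map_add' ξ η := by
    ext m
    exact mul_add _ _ _
  map_smul' a ξ := by
    ext m
    exact mul_left_comm _ _ _
  norm_map' ξ := by
    rw [lp.norm_eq_tsum_rpow (by norm_num), lp.norm_eq_tsum_rpow (by norm_num)]
    congr 1
    rw [← σ.tsum_eq (fun m => ‖ξ m‖ ^ ENNReal.toReal 2)]
    refine tsum_congr fun m => ?_
    change ‖(c m : ℂ) * ξ (σ m)‖ ^ ENNReal.toReal 2 = _
    rw [norm_mul, Circle.norm_coe, one_mul]

theorem weightedPerm_apply {n : ℕ} (σ : Equiv.Perm (Fin n → ℤ)) (c : (Fin n → ℤ) → Circle)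
    (ξ : HSpace n) (m : Fin n → ℤ) : weightedPerm σ c ξ m = (c m : ℂ) * ξ (σ m) :=
  rfl

/-- The unitary `(V_j ξ)(m) = e^{πi ∑_l θ_{jl} m_l} ξ(m - e_j)`. -/
def regularGen {n : ℕ} (Θ : SkewMatrix n) (j : Fin n) : HSpace n ≃ₗᵢ[ℂ] HSpace n :=
  weightedPerm (Equiv.subRight (Pi.single j 1))
    (fun m => Circle.exp (Real.pi * ∑ l, Θ.1 j l * (m l : ℝ)))

theorem regularGen_apply {n : ℕ} (Θ : SkewMatrix n) (j : Fin n) (ξ : HSpace n) (m : Fin n → ℤ) :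
    regularGen Θ j ξ m =
      (Circle.exp (Real.pi * ∑ l, Θ.1 j l * (m l : ℝ)) : ℂ) * ξ (m - Pi.single j 1) :=
  rfl

theorem regularGen_comm {n : ℕ} (Θ : SkewMatrix n) (j k : Fin n) (ξ : HSpace n) (m : Fin n → ℤ) :
    regularGen Θ j (regularGen Θ k ξ) m =
      Complex.exp (2 * Real.pi * Complex.I * (Θ.1 j k : ℂ)) *
        regularGen Θ k (regularGen Θ j ξ) m := by
  have hskew : Θ.1 k j = -Θ.1 j k := by
    have h := congrFun (congrFun Θ.2 j) k
    simpa using h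
  have key : ∀ (j k : Fin n), ∑ l, Θ.1 k l * (((m - Pi.single j 1 : Fin n → ℤ) l : ℤ) : ℝ)
      = ∑ l, Θ.1 k l * (m l : ℝ) - Θ.1 k j := by
    intro j k
    simp [mul_sub, Finset.sum_sub_distrib, Pi.single_apply]
  rw [regularGen_apply, regularGen_apply, regularGen_apply, regularGen_apply, key, key, hskew,
    sub_right_comm m (Pi.single k 1), Circle.coe_exp, Circle.coe_exp, Circle.coe_exp,
    Circle.coe_exp]
  simp only [← mul_assoc, ← Complex.exp_add]
  congr 2
  push_cast
  ring

/-- The regular representation: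
`(V_j ξ)(m) = e^{πi ∑_l θ_{jl} m_l} ξ(m - e_j)`. -/
def regular {n : ℕ} (Θ : SkewMatrix n) : Rep Θ where
  V j := (regularGen Θ j : HSpace n →L[ℂ] HSpace n)
  mem_unitary j := (Unitary.linearIsometryEquiv.symm (regularGen Θ j)).2
  comm_rel j k := by
    refine ContinuousLinearMap.ext fun ξ => lp.ext (funext fun m => ?_)
    exact regularGen_comm Θ j k ξ m

/-- The unit vector `δ₀ ∈ ℓ²(ℤⁿ)`. -/
def vacuum (n : ℕ) : HSpace n := lp.single 2 0 (1 : ℂ)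

/-- The canonical trace `τ` of `A_Θ`, with `τ(U^k) = 0` for `k ≠ 0` and `τ(1) = 1`: the vector state
of `δ₀` in the regular representation. -/
def trace {n : ℕ} {Θ : SkewMatrix n} (a : Torus Θ) : ℂ :=
  inner ℂ (vacuum n) (a.1 (regular Θ) (vacuum n))

/-! ### Functional calculus of `∇` -/

/-- The operator `∇_g = ad_g`, `x ↦ g x - x g`. It is the logarithm of the modular operator
`x ↦ e^g x e^{-g}`. -/
def nabla {A : Type*} [NormedRing A] [NormedAlgebra ℂ A] (g : A) : A →L[ℂ] A :=
  ContinuousLinearMap.mul ℂ A g - (ContinuousLinearMap.mul ℂ A).flip g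

/-- The bounded operator `(e^{-T} - 1) / T`, that is, the entire function
`(e^{-z} - 1) / z = ∑ (-1)^{k+1} z^k / (k+1)!` of the bounded operator `T`. -/
def psi {E : Type*} [NormedAddCommGroup E] [NormedSpace ℂ E] (T : E →L[ℂ] E) : E →L[ℂ] E :=
  ∑' k : ℕ, ((-1 : ℂ) ^ (k + 1) / ((k + 1).factorial : ℂ)) • T ^ k

/-! ### The Einstein-Hilbert action -/

/-- The Einstein-Hilbert action of the conformally flat metric `e^f δ_{ij}` on the
noncommutative four-torus, `Ω(f) = (3/2) ∑ᵢ τ((∂ᵢ e^f) e^{-f} (∂ᵢ e^f))`. -/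
def ehAction {Θ : SkewMatrix 4} (f : Torus Θ) : ℂ :=
  (3 / 2 : ℂ) * ∑ i : Fin 4,
    trace (del i (NormedSpace.exp f) * NormedSpace.exp (-f) * del i (NormedSpace.exp f))

/-- `G` is a gradient of `Ω` at `f` with respect to the pairing `(h, G) ↦ τ(h G)`: it is an element
of `A_Θ^∞`, and for all self-adjoint `h ∈ A_Θ^∞` the derivative of `Ω(f + t h)` at `t = 0` exists
and is `τ(h G)`. -/
structure IsGradient {Θ : SkewMatrix 4} (f G : Torus Θ) : Prop where
  smooth : IsSmooth G
  hasDerivAt : ∀ h : Torus Θ, IsSmooth h → IsSelfAdjoint h →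
    HasDerivAt (fun t : ℝ => ehAction (f + (t : ℂ) • h)) (trace (h * G)) 0

end

end NCTorus

/-! The differential of the exponential is dexp_f(h) = e^f ∫₀¹ e^{-uf} h e^{uf} du = -e^f ψ(∇_f)(h),
where ψ(z) = (e^{-z} - 1)/z (`fderiv_exp_eq_psi`). It is symmetric for the trace pairing,
τ(dexp_f(h) x) = τ(h dexp_f(x)), by traciality and the substitution u ↦ 1 - u (`tr_fderiv_exp_mul`).
The product rule for Ω(f + th) gives three terms for each i: the outer factors vary by
∂ᵢ(dexp_f(h)), the middle one by -dexp_{-f}(h). Integration by parts (`tr_del_mul`) frees dexp_f(h)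
from ∂ᵢ, and the symmetry then frees h, which leaves the three terms of the gradient.

Uniqueness comes from faithfulness of τ (`eq_zero_of_tr_star_mul_self`). For a bounded functional φ,
the mean of φ(α_s(a)) over a cube of periods is φ(1) τ(a). If τ(a* a) = 0 and φ is positive, the
continuous nonnegative function s ↦ φ(α_s(a* a)) has integral zero, so φ(a* a) = 0. The vector
functionals of the representations that define the norm then force a = 0.

The arguments run in a `GaugeSystem`. The torus is one because words in the generators and their
adjoints are homogeneous unitaries with dense span, are scalars in degree zero, and have trace zero
in all other degrees. -/

namespace NCTorus

open scoped ContDiff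

noncomputable section

/-! ### The exponential function of a Banach algebra and its derivatives -/

section BanachAlgebra

open NormedSpace

variable {A : Type*} [NormedRing A] [NormedAlgebra ℂ A] [CompleteSpace A]

theorem contDiff_exp_real : ContDiff ℝ ∞ (exp : A → A) :=
  AnalyticOnNhd.contDiff fun x _ => exp_analytic (𝕂 := ℝ) x

theorem differentiable_exp_real : Differentiable ℝ (exp : A → A) :=
  (contDiff_exp_real (A := A)).differentiable (by simp)

theorem continuous_exp_real_smul (x : A) : Continuous fun u : ℝ => exp (u • x) :=
  contDiff_exp_real.continuous.comp (continuous_id.smul continuous_const)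

theorem exp_neg_mul_exp (x : A) : exp (-x) * exp x = 1 := by
  let _ : NormedAlgebra ℚ A := NormedAlgebra.restrictScalars ℚ ℂ A
  rw [← exp_add_of_commute (Commute.refl x).neg_left, neg_add_cancel, exp_zero]

theorem exp_mul_exp_neg (x : A) : exp x * exp (-x) = 1 := by
  simpa using exp_neg_mul_exp (-x)

/-- Duhamel's formula. -/
theorem exp_neg_mul_exp_sub_one (f g : A) :
    exp (-f) * exp g - 1 = ∫ u in (0 : ℝ)..1, exp (u • -f) * (g - f) * exp (u • g) := by
  have hd : ∀ u : ℝ, HasDerivAt (fun u : ℝ => exp (u • -f) * exp (u • g))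
      (exp (u • -f) * (g - f) * exp (u • g)) u := fun u => by
    refine ((hasDerivAt_exp_smul_const (-f) u).mul
      (hasDerivAt_exp_smul_const' g u)).congr_deriv ?_
    noncomm_ring
  have hc : Continuous fun u : ℝ => exp (u • -f) * (g - f) * exp (u • g) :=
    ((continuous_exp_real_smul _).mul continuous_const).mul (continuous_exp_real_smul _)
  rw [intervalIntegral.integral_eq_sub_of_hasDerivAt (fun u _ => hd u)
    (hc.intervalIntegrable _ _)]
  simp

/-- The derivative of the exponential function of a Banach algebra. -/
theorem fderiv_exp_apply (f h : A) :
    fderiv ℝ exp f h = exp f * ∫ u in (0 : ℝ)..1, exp (u • -f) * h * exp (u • f) := by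
  have hline : HasDerivAt (fun t : ℝ => exp (f + t • h)) (fderiv ℝ exp f h) 0 := by
    have h1 : HasDerivAt (fun t : ℝ => f + t • h) h 0 := by
      simpa using ((hasDerivAt_id (0 : ℝ)).smul_const h).const_add f
    have h2 : HasFDerivAt exp (fderiv ℝ exp f) (f + (0 : ℝ) • h) := by
      simpa using (differentiable_exp_real f).hasFDerivAt
    exact h2.comp_hasDerivAt 0 h1
  -- Duhamel's formula for f and f + th reads e^{f+th} = e^f (1 + t K(t)). Since K is continuous,
  -- the derivative at 0 is e^f K(0).
  set K : ℝ → A := fun t => ∫ u in (0 : ℝ)..1, exp (u • -f) * h * exp (u • (f + t • h)) with hK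
  have hKc : Continuous K := by
    refine intervalIntegral.continuous_parametric_intervalIntegral_of_continuous' ?_ 0 1
    have he : Continuous (exp : A → A) := contDiff_exp_real.continuous
    unfold Function.uncurry
    fun_prop
  have hexp : ∀ t : ℝ, exp (f + t • h) = exp f * (1 + t • K t) := fun t => by
    have h1 := exp_neg_mul_exp_sub_one f (f + t • h)
    have h2 : t • K t = exp (-f) * exp (f + t • h) - 1 := by
      rw [h1, hK, ← intervalIntegral.integral_smul]
      simp
    rw [h2, add_sub_cancel, ← mul_assoc, exp_mul_exp_neg, one_mul]
  have hKd : HasDerivAt (fun t : ℝ => t • K t) (K 0) 0 := by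
    rw [hasDerivAt_iff_tendsto_slope_zero]
    refine ((hKc.tendsto 0).mono_left nhdsWithin_le_nhds).congr' ?_
    filter_upwards [self_mem_nhdsWithin] with t ht
    have ht : t ≠ 0 := ht
    simp [smul_smul, inv_mul_cancel₀ ht]
  have h3 : HasDerivAt (fun t : ℝ => exp (f + t • h)) (exp f * K 0) 0 := by
    simp_rw [hexp]
    exact (hKd.const_add 1).const_mul (exp f)
  rw [hline.unique h3, hK]
  simp

theorem nabla_apply {A : Type*} [NormedRing A] [NormedAlgebra ℂ A] (g x : A) : nabla g x = g * x - x * g := rfl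

/-- The left side y(u) solves y' = -∇_f y with y(0) = x, so e^{uf} y(u) e^{-uf} has derivative zero
and stays equal to x. -/
theorem exp_smul_nabla_apply (f x : A) (u : ℝ) :
    exp (u • -nabla f) x = exp (u • -f) * x * exp (u • f) := by
  set y : ℝ → A := fun u => exp (u • -nabla f) x with hy
  have hyd : ∀ u, HasDerivAt y (-nabla f (y u)) u := fun u => by
    have h := (((ContinuousLinearMap.apply ℂ A x).restrictScalars ℝ).hasFDerivAt).comp_hasDerivAt u
      (hasDerivAt_exp_smul_const' (-nabla f) u)
    exact h
  have hd : ∀ u : ℝ, HasDerivAt (fun u : ℝ => exp (u • f) * y u * exp (u • -f)) 0 u := fun u => by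
    refine (((hasDerivAt_exp_smul_const f u).mul (hyd u)).mul
      (hasDerivAt_exp_smul_const' (-f) u)).congr_deriv ?_
    simp only [nabla_apply, Pi.mul_apply]
    noncomm_ring
  have hconst : exp (u • f) * y u * exp (u • -f) = x := by
    have h := is_const_of_deriv_eq_zero (fun u => (hd u).differentiableAt)
      (fun u => (hd u).deriv) u 0
    simpa [hy] using h
  have h1 : exp (u • -f) * exp (u • f) = 1 := by simpa using exp_neg_mul_exp (u • f)
  calc y u = (exp (u • -f) * exp (u • f)) * y u * (exp (u • -f) * exp (u • f)) := by
        rw [h1, one_mul, mul_one]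
    _ = exp (u • -f) * (exp (u • f) * y u * exp (u • -f)) * exp (u • f) := by
        simp only [mul_assoc]
    _ = _ := by rw [hconst]

/-- `(e^{-T} - 1) / T = -∫₀¹ e^{-uT} du`. -/
theorem psi_eq_neg_integral {E : Type*} [NormedAddCommGroup E] [NormedSpace ℂ E] [CompleteSpace E]
    (T : E →L[ℂ] E) : psi T = -∫ u in (0 : ℝ)..1, exp (u • -T) := by
  have hterm : ∀ (n : ℕ) (u : ℝ), ((n.factorial : ℝ)⁻¹) • (u • -T) ^ n =
      (u ^ n * ((-1) ^ n / (n.factorial : ℝ))) • T ^ n := fun n u => by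
    rw [← neg_one_smul ℝ T, smul_pow, smul_pow, smul_smul, smul_smul]
    congr 1
    ring
  have hsum := intervalIntegral.hasSum_integral_of_dominated_convergence
    (μ := MeasureTheory.volume) (a := 0) (b := 1) (ι := ℕ)
    (F := fun n (u : ℝ) => (u ^ n * ((-1) ^ n / (n.factorial : ℝ))) • T ^ n)
    (f := fun u => exp (u • -T))
    (fun n _ => ‖T ^ n‖ / n.factorial) (fun n => by fun_prop)
    (fun n => by
      refine Filter.Eventually.of_forall fun u hu => ?_
      rw [Set.uIoc_of_le zero_le_one] at hu
      rw [norm_smul, div_eq_inv_mul ‖T ^ n‖]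
      refine mul_le_mul_of_nonneg_right ?_ (norm_nonneg _)
      rw [norm_mul, norm_div, norm_pow, norm_pow, norm_neg, norm_one, one_pow, one_div,
        Real.norm_natCast]
      refine mul_le_of_le_one_left (by positivity) (pow_le_one₀ (norm_nonneg _) ?_)
      rw [Real.norm_of_nonneg hu.1.le]
      exact hu.2)
    (Filter.Eventually.of_forall fun u _ => by
      simpa [norm_smul, div_eq_inv_mul] using norm_expSeries_summable' (𝕂 := ℝ) T)
    intervalIntegrable_const
    (Filter.Eventually.of_forall fun u _ => by
      simpa only [hterm] using exp_series_hasSum_exp' (𝕂 := ℝ) (u • -T))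
  rw [← hsum.tsum_eq, ← tsum_neg, psi]
  refine tsum_congr fun n => ?_
  -- The factor ∫₀¹ uⁿ du = 1/(n+1) turns 1/n! into 1/(n+1)!, and the outer sign turns (-1)ⁿ into
  -- (-1)ⁿ⁺¹.
  rw [intervalIntegral.integral_smul_const, intervalIntegral.integral_mul_const, integral_pow,
    ← neg_smul, ← Complex.coe_smul]
  congr 1
  push_cast [Nat.factorial_succ]
  field_simp
  ring

theorem psi_nabla_apply (f x : A) :
    psi (nabla f) x = -∫ u in (0 : ℝ)..1, exp (u • -f) * x * exp (u • f) := by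
  have hc := (continuous_exp_real_smul (-nabla f)).intervalIntegrable (μ := MeasureTheory.volume)
    (0 : ℝ) 1
  rw [psi_eq_neg_integral, neg_apply,
    ContinuousLinearMap.intervalIntegral_apply hc]
  simp_rw [exp_smul_nabla_apply]

theorem fderiv_exp_eq_psi (f h : A) : fderiv ℝ exp f h = -(exp f * psi (nabla f) h) := by
  rw [fderiv_exp_apply, psi_nabla_apply, mul_neg, neg_neg]

/-- The second derivative of the exponential function. -/
def expSnd (f a b : A) : A := fderiv ℝ (fderiv ℝ exp) f a b

/-- Symmetry of second derivatives; this is what makes the variation in f commute with the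
derivations. -/
theorem expSnd_symm (f a b : A) : expSnd f a b = expSnd f b a :=
  (contDiff_exp_real.contDiffAt.isSymmSndFDerivAt (by
    rw [minSmoothness_of_isRCLikeNormedField]
    exact WithTop.coe_le_coe.2 le_top)).eq a b

theorem hasDerivAt_fderiv_exp {x y : ℝ → A} {x' y' : A} {t : ℝ} (hx : HasDerivAt x x' t)
    (hy : HasDerivAt y y' t) : HasDerivAt (fun t => fderiv ℝ exp (x t) (y t))
      (expSnd (x t) x' (y t) + fderiv ℝ exp (x t) y') t := by
  have hd : HasFDerivAt (fderiv ℝ exp) (fderiv ℝ (fderiv ℝ exp) (x t)) (x t) :=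
    ((contDiff_exp_real.fderiv_right (m := ∞) (by simp)).differentiable (by simp) _).hasFDerivAt
  exact (hd.comp_hasDerivAt t hx).clm_apply hy

end BanachAlgebra
end
end NCTorus

namespace NCTorus

open scoped ContDiff

noncomputable section

/-! ### Words in the generators and their degrees -/

section Words

variable {n : ℕ} (Θ : SkewMatrix n)

/-- The inclusion of the torus into the ambient algebra. -/
def toAmbient : Torus Θ →⋆ₐ[ℂ] Ambient Θ := (torusSubalgebra Θ).subtype

theorem isometry_toAmbient : Isometry (toAmbient Θ) := fun _ _ => rfl

theorem toAmbient_injective : Function.Injective (toAmbient Θ) :=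
  (isometry_toAmbient Θ).injective

theorem toAmbient_U (j : Fin n) : toAmbient Θ (U Θ j) = ambientGen Θ j := rfl

theorem toAmbient_action (s : Fin n → ℝ) (a : Torus Θ) (ρ : Rep Θ) :
    toAmbient Θ (action Θ s a) ρ = toAmbient Θ a (ρ.rotate s) := rfl

theorem U_mem_unitary (j : Fin n) : U Θ j ∈ unitary (Torus Θ) := by
  rw [Unitary.mem_iff]
  constructor <;> apply toAmbient_injective <;> ext1 ρ <;>
    simp only [map_mul, map_star, map_one, toAmbient_U]
  · exact (Unitary.mem_iff.1 (ρ.mem_unitary j)).1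
  · exact (Unitary.mem_iff.1 (ρ.mem_unitary j)).2

theorem U_mul_U (j k : Fin n) : U Θ j * U Θ k =
    Complex.exp (2 * Real.pi * Complex.I * (Θ.1 j k : ℂ)) • (U Θ k * U Θ j) := by
  apply toAmbient_injective
  ext1 ρ
  simp only [map_mul, map_smul, toAmbient_U]
  exact ρ.comm_rel j k

theorem action_U (s : Fin n → ℝ) (j : Fin n) :
    action Θ s (U Θ j) = Complex.exp (Complex.I * (s j : ℂ)) • U Θ j := rfl

/-- The pairs `(k, w)`, where `w` is a product of generators and their adjoints, of degree `k`. -/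
def words : Submonoid ((Fin n → Multiplicative ℤ) × Torus Θ) :=
  Submonoid.closure (Set.range (fun j => (Pi.mulSingle j (Multiplicative.ofAdd 1), U Θ j)) ∪
    Set.range (fun j => ((Pi.mulSingle j (Multiplicative.ofAdd 1))⁻¹, star (U Θ j))))

variable {Θ}

theorem words_induction {p : (Fin n → Multiplicative ℤ) → Torus Θ → Prop} (one : p 1 1)
    (mul : ∀ k l v w, p k v → p l w → p (k * l) (v * w))
    (gen : ∀ j, p (Pi.mulSingle j (Multiplicative.ofAdd 1)) (U Θ j))
    (gen_star : ∀ j, p (Pi.mulSingle j (Multiplicative.ofAdd 1))⁻¹ (star (U Θ j)))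
    {k : Fin n → Multiplicative ℤ} {w : Torus Θ} (h : (k, w) ∈ words Θ) : p k w := by
  refine Submonoid.closure_induction (motive := fun x _ => p x.1 x.2) ?_ one
    (fun x y _ _ hx hy => mul _ _ _ _ hx hy) h
  rintro _ (⟨j, rfl⟩ | ⟨j, rfl⟩)
  exacts [gen j, gen_star j]

theorem words_mem_unitary {k : Fin n → Multiplicative ℤ} {w : Torus Θ} (h : (k, w) ∈ words Θ) :
    w ∈ unitary (Torus Θ) :=
  words_induction (p := fun _ w => w ∈ unitary (Torus Θ)) (one_mem _)
    (fun _ _ _ _ => mul_mem) (U_mem_unitary Θ)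
    (fun j => Unitary.star_mem (U_mem_unitary Θ j)) h

/-- The pairing of a degree with a point of `ℝⁿ`. -/
def phase (k : Fin n → Multiplicative ℤ) (s : Fin n → ℝ) : ℂ :=
  ∏ j, Complex.exp (Complex.I * ((k j).toAdd : ℂ) * (s j : ℂ))

theorem phase_mul (k l : Fin n → Multiplicative ℤ) (s : Fin n → ℝ) :
    phase (k * l) s = phase k s * phase l s := by
  simp only [phase, ← Finset.prod_mul_distrib, ← Complex.exp_add]
  refine Finset.prod_congr rfl fun j _ => ?_
  simp
  ring_nf

theorem phase_one (s : Fin n → ℝ) : phase 1 s = 1 := by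
  simp [phase]

theorem phase_mulSingle (j : Fin n) (s : Fin n → ℝ) :
    phase (Pi.mulSingle j (Multiplicative.ofAdd 1)) s = Complex.exp (Complex.I * (s j : ℂ)) := by
  rw [phase, Finset.prod_eq_single j]
  · simp
  · intro i _ hi
    simp [Pi.mulSingle_eq_of_ne hi]
  · simp

theorem phase_inv (k : Fin n → Multiplicative ℤ) (s : Fin n → ℝ) :
    phase k⁻¹ s = star (phase k s) := by
  simp [phase, ← Complex.exp_conj]

theorem action_word {k : Fin n → Multiplicative ℤ} {w : Torus Θ} (h : (k, w) ∈ words Θ)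
    (s : Fin n → ℝ) : action Θ s w = phase k s • w := by
  refine words_induction (p := fun k w => action Θ s w = phase k s • w) ?_ ?_ ?_ ?_ h
  · simp [phase_one]
  · intro k l v w hv hw
    rw [map_mul, hv, hw, phase_mul, smul_mul_smul_comm]
  · intro j
    rw [phase_mulSingle, action_U]
  · intro j
    rw [map_star, action_U, star_smul, phase_inv, phase_mulSingle]

variable (Θ) in
/-- The unitary scalars. -/
def scalarUnitaries : Subgroup (unitary (Torus Θ)) where
  carrier := {u | ∃ c : ℂ, (u : Torus Θ) = c • 1}
  one_mem' := ⟨1, by simp⟩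
  mul_mem' := by
    rintro u v ⟨c, hc⟩ ⟨d, hd⟩
    exact ⟨c * d, by rw [Submonoid.coe_mul, hc, hd, smul_mul_smul_comm, one_mul]⟩
  inv_mem' := by
    rintro u ⟨c, hc⟩
    exact ⟨star c, by rw [← Unitary.star_eq_inv, Unitary.coe_star, hc, star_smul, star_one]⟩

instance : (scalarUnitaries Θ).Normal where
  conj_mem := by
    rintro u ⟨c, hc⟩ v
    refine ⟨c, ?_⟩
    rw [Submonoid.coe_mul, Submonoid.coe_mul, hc, mul_smul_comm, mul_one, smul_mul_assoc,
      ← Submonoid.coe_mul, mul_inv_cancel, Submonoid.coe_one]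

variable (Θ) in
/-- The class of a generator modulo scalars. -/
def genClass (j : Fin n) : unitary (Torus Θ) ⧸ scalarUnitaries Θ :=
  QuotientGroup.mk ⟨U Θ j, U_mem_unitary Θ j⟩

/-- Exchanging two generators costs only a scalar, which is invisible in the quotient. Hence the
classes define a homomorphism on ℤⁿ. -/
theorem genClass_commute (i j : Fin n) : Commute (genClass Θ i) (genClass Θ j) := by
  change (QuotientGroup.mk _ : unitary (Torus Θ) ⧸ scalarUnitaries Θ) = QuotientGroup.mk _
  rw [QuotientGroup.eq]
  set u : unitary (Torus Θ) := ⟨U Θ i, U_mem_unitary Θ i⟩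
  set v : unitary (Torus Θ) := ⟨U Θ j, U_mem_unitary Θ j⟩
  refine ⟨Complex.exp (2 * Real.pi * Complex.I * (Θ.1 j i : ℂ)), ?_⟩
  have h : ((v * u : unitary (Torus Θ)) : Torus Θ) =
      Complex.exp (2 * Real.pi * Complex.I * (Θ.1 j i : ℂ)) • ((u * v : unitary (Torus Θ)) : Torus Θ) :=
    U_mul_U Θ j i
  rw [Submonoid.coe_mul, h, mul_smul_comm, ← Submonoid.coe_mul, inv_mul_cancel, Submonoid.coe_one]

theorem genClass_zpowers_commute : Pairwise fun i j => ∀ x y : Multiplicative ℤ,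
    Commute (zpowersHom _ (genClass Θ i) x) (zpowersHom _ (genClass Θ j) y) := fun i j _ x y => by
  simpa only [zpowersHom_apply] using (genClass_commute i j).zpow_zpow _ _

variable (Θ) in
/-- The class modulo scalars of the words of a given degree. -/
def degreeClass : (Fin n → Multiplicative ℤ) →* unitary (Torus Θ) ⧸ scalarUnitaries Θ :=
  MonoidHom.noncommPiCoprod (fun j => zpowersHom _ (genClass Θ j)) genClass_zpowers_commute

theorem degreeClass_mulSingle (j : Fin n) :
    degreeClass Θ (Pi.mulSingle j (Multiplicative.ofAdd 1)) = genClass Θ j := by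
  simp [degreeClass]

/-- Modulo scalars a word depends only on its degree, so no normal ordering of its letters is
needed. -/
theorem mk_word {k : Fin n → Multiplicative ℤ} {w : Torus Θ} (h : (k, w) ∈ words Θ) :
    ∃ u : unitary (Torus Θ), (u : Torus Θ) = w ∧ QuotientGroup.mk u = degreeClass Θ k := by
  refine words_induction (p := fun k w => ∃ u : unitary (Torus Θ), (u : Torus Θ) = w ∧
    QuotientGroup.mk u = degreeClass Θ k) ⟨1, rfl, (map_one _).symm⟩ ?_ ?_ ?_ h
  · rintro k l _ _ ⟨u, rfl, hu⟩ ⟨v, rfl, hv⟩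
    exact ⟨u * v, rfl, by rw [map_mul, ← hu, ← hv, QuotientGroup.mk_mul]⟩
  · exact fun j => ⟨_, rfl, (degreeClass_mulSingle j).symm⟩
  · exact fun j => ⟨(⟨U Θ j, U_mem_unitary Θ j⟩ : unitary (Torus Θ))⁻¹, rfl, by
      rw [map_inv, degreeClass_mulSingle]; rfl⟩

theorem word_of_degree_one {w : Torus Θ} (h : (1, w) ∈ words Θ) : ∃ c : ℂ, w = c • 1 := by
  obtain ⟨u, rfl, hu⟩ := mk_word h
  rw [map_one, QuotientGroup.eq_one_iff] at hu
  exact hu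

-- The inclusion into the ambient algebra is isometric, so density can be tested there. The torus is
-- by definition the closure of the star algebra generated by the U_j, and that star algebra is the
-- span of the words.
variable (Θ) in
theorem dense_span_words :
    Dense ((Submodule.span ℂ ({w | ∃ k, (k, w) ∈ words Θ}) : Submodule ℂ (Torus Θ)) :
      Set (Torus Θ)) := by
  intro a
  rw [(isometry_toAmbient Θ).isUniformInducing.isInducing.closure_eq_preimage_closure_image]
  have ha : toAmbient Θ a ∈ closure (StarAlgebra.adjoin ℂ (Set.range (ambientGen Θ)) : Set _) :=
    a.2
  refine closure_mono ?_ ha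
  intro b hb
  have hb' : b ∈ Subalgebra.toSubmodule
    (StarAlgebra.adjoin ℂ (Set.range (ambientGen Θ))).toSubalgebra := hb
  rw [StarAlgebra.adjoin_eq_span] at hb'
  have hle : Submodule.span ℂ (Submonoid.closure (Set.range (ambientGen Θ) ∪
      star (Set.range (ambientGen Θ))) : Set (Ambient Θ)) ≤
      (Submodule.span ℂ ({w | ∃ k, (k, w) ∈ words Θ})).map (toAmbient Θ).toAlgHom.toLinearMap := by
    rw [Submodule.map_span, Submodule.span_le]
    refine fun x hx => Submodule.subset_span ?_
    have hle2 : Submonoid.closure (Set.range (ambientGen Θ) ∪ star (Set.range (ambientGen Θ))) ≤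
        ((words Θ).map (MonoidHom.snd _ _)).map (toAmbient Θ : Torus Θ →* Ambient Θ) := by
      rw [Submonoid.closure_le]
      rintro x (⟨j, rfl⟩ | ⟨j, hj⟩)
      · exact ⟨U Θ j, ⟨_, Submonoid.subset_closure (Or.inl ⟨j, rfl⟩), rfl⟩, rfl⟩
      · refine ⟨star (U Θ j), ⟨_, Submonoid.subset_closure (Or.inr ⟨j, rfl⟩), rfl⟩, ?_⟩
        change toAmbient Θ (star (U Θ j)) = x
        rw [map_star, toAmbient_U, hj, star_star]
    obtain ⟨_, ⟨y, hy, rfl⟩, rfl⟩ := hle2 hx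
    exact ⟨_, ⟨_, hy⟩, rfl⟩
  obtain ⟨c, hc, rfl⟩ := hle hb'
  exact ⟨c, hc, rfl⟩

end Words
end
end NCTorus

namespace NCTorus

open scoped ContDiff

noncomputable section

/-! ### The regular representation and the canonical trace -/

section Trace

variable {n : ℕ} {Θ : SkewMatrix n}

/-- The evaluation of an element of the torus in a representation. -/
def evalRep (ρ : Rep Θ) : Torus Θ →⋆ₐ[ℂ] (HSpace n →L[ℂ] HSpace n) where
  toFun a := toAmbient Θ a ρ
  map_one' := rfl
  map_mul' _ _ := rfl
  map_zero' := rfl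
  map_add' _ _ := rfl
  commutes' _ := rfl
  map_star' _ := rfl

theorem evalRep_U (ρ : Rep Θ) (j : Fin n) : evalRep ρ (U Θ j) = ρ.V j := rfl

theorem norm_evalRep_le (ρ : Rep Θ) (a : Torus Θ) : ‖evalRep ρ a‖ ≤ ‖a‖ :=
  BoundedContinuousFunction.norm_coe_le_norm (toAmbient Θ a) ρ

theorem eq_zero_of_evalRep {a : Torus Θ} (h : ∀ ρ ξ, evalRep ρ a ξ = 0) : a = 0 :=
  toAmbient_injective Θ (BoundedContinuousFunction.ext fun ρ => ContinuousLinearMap.ext (h ρ))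

/-- The functional `a ↦ ⟨ξ, a ξ⟩` in a representation. -/
def vectorFunctional (ρ : Rep Θ) (ξ : HSpace n) : Torus Θ →L[ℂ] ℂ :=
  LinearMap.mkContinuous
    { toFun := fun a => inner ℂ ξ (evalRep ρ a ξ)
      map_add' := fun a b => by rw [map_add, add_apply, inner_add_right]
      map_smul' := fun c a => by
        rw [map_smul, smul_apply, inner_smul_right, RingHom.id_apply, smul_eq_mul] }
    (‖ξ‖ * ‖ξ‖) fun a => by
      refine (norm_inner_le_norm (𝕜 := ℂ) ξ (evalRep ρ a ξ)).trans ?_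
      rw [mul_assoc]
      refine mul_le_mul_of_nonneg_left ?_ (norm_nonneg _)
      rw [mul_comm]
      exact ((evalRep ρ a).le_opNorm ξ).trans
        (mul_le_mul_of_nonneg_right (norm_evalRep_le ρ a) (norm_nonneg _))

theorem vectorFunctional_apply (ρ : Rep Θ) (ξ : HSpace n) (a : Torus Θ) :
    vectorFunctional ρ ξ a = inner ℂ ξ (evalRep ρ a ξ) := rfl

theorem vectorFunctional_star_mul_self (ρ : Rep Θ) (ξ : HSpace n) (a : Torus Θ) :
    vectorFunctional ρ ξ (star a * a) = ((‖evalRep ρ a ξ‖ ^ 2 : ℝ) : ℂ) := by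
  rw [vectorFunctional_apply, map_mul, map_star, mul_apply_eq_comp,
    ContinuousLinearMap.star_eq_adjoint, ContinuousLinearMap.adjoint_inner_right,
    inner_self_eq_norm_sq_to_K]
  push_cast
  rfl

variable (Θ) in
/-- The canonical trace as a continuous linear functional. -/
def traceCLM : Torus Θ →L[ℂ] ℂ := vectorFunctional (regular Θ) (vacuum n)

theorem traceCLM_apply (a : Torus Θ) : traceCLM Θ a = trace a := rfl

theorem vacuum_zero : (vacuum n : HSpace n) 0 = 1 := by
  simp [vacuum]

theorem vacuum_of_ne_zero {m : Fin n → ℤ} (hm : m ≠ 0) : (vacuum n : HSpace n) m = 0 := by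
  simp [vacuum, hm]

theorem trace_eq_apply_zero (a : Torus Θ) :
    trace a = (evalRep (regular Θ) a (vacuum n) : HSpace n) 0 := by
  change inner ℂ (vacuum n) (evalRep (regular Θ) a (vacuum n)) = _
  rw [vacuum, lp.inner_single_left]
  simp

theorem trace_one : trace (1 : Torus Θ) = 1 := by
  rw [trace_eq_apply_zero, map_one, one_apply_eq_self, vacuum_zero]

theorem weightedPerm_symm_apply (σ : Equiv.Perm (Fin n → ℤ)) (c : (Fin n → ℤ) → Circle)
    (ξ : HSpace n) (m : Fin n → ℤ) :
    (weightedPerm σ c).symm ξ m = ((c (σ.symm m))⁻¹ : ℂ) * ξ (σ.symm m) := rfl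

variable (Θ) in
theorem regularGen_symm_apply (j : Fin n) (ξ : HSpace n) (m : Fin n → ℤ) :
    ∃ c : ℂ, (regularGen Θ j).symm ξ m = c * ξ (m + Pi.single j 1) :=
  ⟨_, weightedPerm_symm_apply _ _ ξ m⟩

/-- In the regular representation, a word of degree `k` translates supports by `k`. -/
theorem word_apply_eq_zero {k : Fin n → Multiplicative ℤ} {w : Torus Θ} (h : (k, w) ∈ words Θ) :
    ∀ (ξ : HSpace n) (m : Fin n → ℤ), (∀ l, l ≠ m → ξ l = 0) →
      ∀ l, (l ≠ fun j => m j + (k j).toAdd) → (evalRep (regular Θ) w ξ : HSpace n) l = 0 := by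
  refine words_induction (p := fun k w => ∀ (ξ : HSpace n) (m : Fin n → ℤ),
    (∀ l, l ≠ m → ξ l = 0) → ∀ l, (l ≠ fun j => m j + (k j).toAdd) →
      (evalRep (regular Θ) w ξ : HSpace n) l = 0) ?_ ?_ ?_ ?_ h
  · intro ξ m hξ l hl
    rw [map_one, one_apply_eq_self]
    exact hξ l (by simpa using hl)
  · intro k k' v w hv hw ξ m hξ l hl
    rw [map_mul, mul_apply_eq_comp]
    refine hv _ _ (hw ξ m hξ) l fun h => hl ?_
    rw [h]
    funext j
    simp
    ring
  · intro j ξ m hξ l hl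
    rw [evalRep_U]
    change regularGen Θ j ξ l = 0
    rw [regularGen_apply, hξ, mul_zero]
    rintro rfl
    refine hl (funext fun i => ?_)
    rcases eq_or_ne i j with rfl | hij
    · simp
    · simp [hij]
  · intro j ξ m hξ l hl
    rw [map_star, evalRep_U]
    have hstar : star ((regular Θ).V j) = ((regularGen Θ j).symm : HSpace n →L[ℂ] HSpace n) :=
      LinearIsometryEquiv.star_eq_symm (regularGen Θ j)
    rw [hstar]
    obtain ⟨c, hc⟩ := regularGen_symm_apply Θ j ξ l
    refine hc.trans ?_
    rw [hξ, mul_zero]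
    rintro rfl
    refine hl (funext fun i => ?_)
    rcases eq_or_ne i j with rfl | hij
    · simp
    · simp [hij]

/-- The word moves the support of δ₀ from 0 to k ≠ 0, so the coefficient at 0 vanishes. -/
theorem trace_word_of_ne_one {k : Fin n → Multiplicative ℤ} {w : Torus Θ} (h : (k, w) ∈ words Θ)
    (hk : k ≠ 1) : trace w = 0 := by
  rw [trace_eq_apply_zero]
  refine word_apply_eq_zero h (vacuum n) 0 (fun l => vacuum_of_ne_zero) 0 fun h0 => hk ?_
  funext j
  have := congrFun h0 j
  simp only [Pi.zero_apply, zero_add] at this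
  exact (toAdd_eq_zero.1 this.symm)

theorem word_of_degree_one_eq_trace {w : Torus Θ} (h : (1, w) ∈ words Θ) : w = trace w • 1 := by
  obtain ⟨c, rfl⟩ := word_of_degree_one h
  rw [← traceCLM_apply, map_smul, traceCLM_apply, trace_one, smul_eq_mul, mul_one]

end Trace
end
end NCTorus

/-! ### Gauge systems: traciality and invariance of the trace -/

namespace NCTorus

open scoped ContDiff

noncomputable section

/-- A C⋆-algebra with an action of `ℝⁿ`, a functional `τ` and a spanning multiplicative system of
homogeneous unitaries, the words, such that the words of degree zero are scalars and `τ` is the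
projection to degree zero. -/
structure GaugeSystem (n : ℕ) (A : Type*) [CStarAlgebra A] where
  act : (Fin n → ℝ) → A →⋆ₐ[ℂ] A
  act_add : ∀ s t a, act (s + t) a = act s (act t a)
  words : Submonoid ((Fin n → Multiplicative ℤ) × A)
  mem_unitary : ∀ k w, (k, w) ∈ words → w ∈ unitary A
  act_word : ∀ k w, (k, w) ∈ words → ∀ s, act s w = phase k s • w
  dense_span : Dense ((Submodule.span ℂ {w | ∃ k, (k, w) ∈ words} : Submodule ℂ A) : Set A)
  tr : A →L[ℂ] ℂ
  tr_word : ∀ k w, (k, w) ∈ words → k ≠ 1 → tr w = 0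
  word_eq_tr : ∀ w, (1, w) ∈ words → w = tr w • 1
  separating : ∀ a, (∀ φ : A →L[ℂ] ℂ, (∀ b, ∃ r : ℝ, 0 ≤ r ∧ φ (star b * b) = r) →
    φ (star a * a) = 0) → a = 0

namespace GaugeSystem

variable {n : ℕ} {A : Type*} [CStarAlgebra A] (S : GaugeSystem n A)

section Trace

theorem clm_ext_words {E : Type*} [NormedAddCommGroup E] [NormedSpace ℂ E]
    {P Q : A →L[ℂ] E} (h : ∀ k w, (k, w) ∈ S.words → P w = Q w) (a : A) :
    P a = Q a := by
  have := ContinuousLinearMap.ext_on (S.dense_span) (f := P) (g := Q)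
    (by rintro w ⟨k, hw⟩; exact h k w hw)
  rw [this]

/-- In nonzero total degree both traces vanish. In degree zero vw is a scalar, so w is a multiple of
v* and commutes with the unitary v. -/
theorem tr_mul_comm_words {k l : Fin n → Multiplicative ℤ} {v w : A}
    (hv : (k, v) ∈ S.words) (hw : (l, w) ∈ S.words) : S.tr (v * w) = S.tr (w * v) := by
  have h1 : (k * l, v * w) ∈ S.words := mul_mem hv hw
  have h2 : (k * l, w * v) ∈ S.words := by
    rw [mul_comm k l]
    exact mul_mem hw hv
  rcases eq_or_ne (k * l) 1 with hkl | hkl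
  · rw [hkl] at h1 h2
    have hu := Unitary.mem_iff.1 (S.mem_unitary _ _ hv)
    have h3 : v * w = w * v := by
      obtain ⟨c, hc⟩ : ∃ c : ℂ, v * w = c • 1 := ⟨_, S.word_eq_tr _ h1⟩
      have h4 : w = c • star v := by
        calc w = star v * (v * w) := by rw [← mul_assoc, hu.1, one_mul]
          _ = c • star v := by rw [hc, mul_smul_comm, mul_one]
      rw [hc, h4, smul_mul_assoc, hu.1]
    rw [h3]
  · rw [S.tr_word _ _ h1 hkl, S.tr_word _ _ h2 hkl]

theorem tr_mul_comm (a b : A) : S.tr (a * b) = S.tr (b * a) := by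
  have h1 : ∀ {k} {w : A}, (k, w) ∈ S.words → ∀ a, S.tr (a * w) = S.tr (w * a) :=
    fun {k w} hw a => S.clm_ext_words
      (P := (S.tr).comp ((ContinuousLinearMap.mul ℂ (A)).flip w))
      (Q := (S.tr).comp (ContinuousLinearMap.mul ℂ (A) w))
      (fun _ _ hv => S.tr_mul_comm_words hv hw) a
  exact S.clm_ext_words
      (P := (S.tr).comp (ContinuousLinearMap.mul ℂ (A) a))
      (Q := (S.tr).comp ((ContinuousLinearMap.mul ℂ (A)).flip a))
      (fun _ _ hv => h1 hv a) b

theorem norm_act_le (s : Fin n → ℝ) (a : A) : ‖S.act s a‖ ≤ ‖a‖ :=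
  NonUnitalStarAlgHom.norm_apply_le (S.act s) a

/-- The action as a continuous linear map. -/
def actCLM (s : Fin n → ℝ) : A →L[ℂ] A :=
  LinearMap.mkContinuous (S.act s).toAlgHom.toLinearMap 1 fun a => by
    rw [one_mul]
    exact S.norm_act_le s a

theorem actCLM_apply (s : Fin n → ℝ) (a : A) : S.actCLM s a = S.act s a := rfl

/-- Words of degree zero are fixed by the action, and all other words are killed by the trace. -/
theorem tr_act (s : Fin n → ℝ) (a : A) : S.tr (S.act s a) = S.tr a := by
  refine S.clm_ext_words (P := (S.tr).comp (S.actCLM s)) (Q := S.tr) ?_ a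
  intro k w hw
  rw [ContinuousLinearMap.comp_apply, S.actCLM_apply, S.act_word _ _ hw, map_smul]
  rcases eq_or_ne k 1 with rfl | hk
  · rw [phase_one, one_smul]
  · rw [S.tr_word _ _ hw hk, smul_zero]

theorem continuous_phase (k : Fin n → Multiplicative ℤ) : Continuous (phase k) := by
  unfold phase
  fun_prop

/-- The action is contractive, so approximating a by combinations of words approximates its orbit
map uniformly by trigonometric polynomials. -/
theorem continuous_act (a : A) : Continuous fun s => S.act s a := by
  refine continuous_of_uniform_approx_of_continuous fun V hV => ?_
  obtain ⟨ε, hε, hV⟩ := Metric.mem_uniformity_dist.1 hV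
  obtain ⟨b, hb, hab⟩ := Metric.mem_closure_iff.1 (S.dense_span a) ε hε
  refine ⟨fun s => S.act s b, ?_, fun s => hV ?_⟩
  · refine Submodule.span_induction (p := fun b _ => Continuous fun s => S.act s b)
      ?_ ?_ ?_ ?_ hb
    · rintro w ⟨k, hw⟩
      simp_rw [S.act_word _ _ hw]
      exact (continuous_phase k).smul continuous_const
    · simpa using continuous_const
    · intro x y _ _ hx hy
      simp only [map_add]
      exact Continuous.add hx hy
    · intro c x _ hx
      simp only [map_smul]
      exact Continuous.const_smul hx c
  · rw [dist_eq_norm, ← map_sub]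
    exact (S.norm_act_le s _).trans_lt (by rwa [dist_eq_norm] at hab)

/-! ### Averaging over the action and faithfulness of the trace -/

open MeasureTheory

/-- Lebesgue measure on the cube `(-π, π)ⁿ`. -/
def cubeMeasure (n : ℕ) : Measure (Fin n → ℝ) :=
  Measure.pi fun _ => volume.restrict (Set.Ioo (-Real.pi) Real.pi)

instance : IsFiniteMeasure (cubeMeasure n) := by
  unfold cubeMeasure
  infer_instance

theorem cubeMeasure_eq_restrict :
    cubeMeasure n = volume.restrict (Set.univ.pi fun _ => Set.Ioo (-Real.pi) Real.pi) := by
  rw [cubeMeasure, volume_pi, Measure.restrict_pi_pi]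

/-- The integral factors over the coordinates, and a coordinate with k_j ≠ 0 contributes the
integral of a nontrivial character over full periods. -/
theorem integral_phase_of_ne_one {k : Fin n → Multiplicative ℤ} (hk : k ≠ 1) :
    ∫ s, phase k s ∂cubeMeasure n = 0 := by
  obtain ⟨j, hj⟩ := Function.ne_iff.1 hk
  have hj' : ((k j).toAdd : ℂ) ≠ 0 := by
    exact_mod_cast fun h => hj (toAdd_eq_zero.1 h)
  unfold phase cubeMeasure
  rw [integral_fintype_prod_eq_prod
    (f := fun j (x : ℝ) => Complex.exp (Complex.I * ((k j).toAdd : ℂ) * (x : ℂ)))]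
  refine Finset.prod_eq_zero (Finset.mem_univ j) ?_
  rw [← integral_Ioc_eq_integral_Ioo, ← intervalIntegral.integral_of_le
    (by linarith [Real.pi_pos]), integral_exp_mul_complex (mul_ne_zero Complex.I_ne_zero hj')]
  have h : Complex.exp (Complex.I * ((k j).toAdd : ℂ) * (Real.pi : ℝ)) =
      Complex.exp (Complex.I * ((k j).toAdd : ℂ) * ((-Real.pi : ℝ) : ℂ)) := by
    rw [Complex.exp_eq_exp_iff_exists_int]
    refine ⟨(k j).toAdd, ?_⟩
    push_cast
    ring
  rw [h, sub_self, zero_div]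

theorem integrable_act (φ : A →L[ℂ] ℂ) (a : A) :
    Integrable (fun s => φ (S.act s a)) (cubeMeasure n) := by
  refine Integrable.of_bound (φ.continuous.comp (S.continuous_act a)).aestronglyMeasurable
    (‖φ‖ * ‖a‖) (Filter.Eventually.of_forall fun s => ?_)
  exact (φ.le_opNorm _).trans (mul_le_mul_of_nonneg_left (S.norm_act_le s a) (norm_nonneg _))

/-- The average of a functional over the action. -/
def averageFunctional (φ : A →L[ℂ] ℂ) : A →L[ℂ] ℂ :=
  LinearMap.mkContinuous
    { toFun := fun a => ∫ s, φ (S.act s a) ∂cubeMeasure n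
      map_add' := fun a b => by
        simp_rw [map_add]
        exact integral_add (S.integrable_act φ a) (S.integrable_act φ b)
      map_smul' := fun c a => by
        simp_rw [map_smul]
        exact integral_smul _ _ }
    (‖φ‖ * (cubeMeasure n).real Set.univ) fun a => by
      refine (norm_integral_le_of_norm_le_const (C := ‖φ‖ * ‖a‖)
        (Filter.Eventually.of_forall fun s => (φ.le_opNorm _).trans
          (mul_le_mul_of_nonneg_left (S.norm_act_le s a) (norm_nonneg _)))).trans_eq ?_
      ring

/-- Averaging over the action yields the trace. -/
theorem integral_act (φ : A →L[ℂ] ℂ) (a : A) :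
    ∫ s, φ (S.act s a) ∂cubeMeasure n =
      ((cubeMeasure n).real Set.univ * φ 1) * S.tr a := by
  refine S.clm_ext_words (P := S.averageFunctional φ)
    (Q := (((cubeMeasure n).real Set.univ : ℂ) * φ 1) • S.tr) ?_ a
  intro k w hw
  change ∫ s, φ (S.act s w) ∂cubeMeasure n = _
  simp_rw [S.act_word _ _ hw, map_smul, smul_eq_mul]
  rw [integral_mul_const, smul_apply]
  rcases eq_or_ne k 1 with rfl | hk
  · have h := S.word_eq_tr _ hw
    simp_rw [phase_one]
    rw [integral_const, h, map_smul, ← h]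
    simp
    ring
  · rw [integral_phase_of_ne_one hk, S.tr_word _ _ hw hk, zero_mul, smul_zero]

theorem act_zero (a : A) : S.act 0 a = a := by
  refine S.clm_ext_words (P := S.actCLM 0) (Q := .id ℂ _) (fun k w hw => ?_) a
  rw [S.actCLM_apply, S.act_word _ _ hw]
  simp [phase]

/-- The canonical trace is faithful. -/
theorem eq_zero_of_tr_star_mul_self {a : A} (h : S.tr (star a * a) = 0) : a = 0 := by
  refine S.separating a fun φ hφ => ?_
  choose r hr hφr using hφ
  have h1 := S.integral_act φ (star a * a)
  rw [h, mul_zero] at h1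
  simp_rw [map_mul, map_star, hφr] at h1
  rw [integral_complex_ofReal] at h1
  have h1 : ∫ s, r (S.act s a) ∂cubeMeasure n = 0 := by exact_mod_cast h1
  have hc : Continuous fun s => r (S.act s a) := by
    have h2 := Complex.continuous_re.comp (φ.continuous.comp
      ((S.continuous_act a).star.mul (S.continuous_act a)))
    simpa only [Function.comp_def, Pi.mul_apply, hφr, Complex.ofReal_re] using h2
  have hi : Integrable (fun s => r (S.act s a)) (cubeMeasure n) := by
    have h2 := (S.integrable_act φ (star a * a)).re
    simpa only [map_mul, map_star, hφr, RCLike.re_to_complex, Complex.ofReal_re] using h2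
  rw [integral_eq_zero_iff_of_nonneg (fun s => hr _) hi, cubeMeasure_eq_restrict] at h1
  -- On the open cube a continuous function that vanishes almost everywhere vanishes everywhere, in
  -- particular at s = 0, where the action is trivial.
  have h2 := Measure.eqOn_open_of_ae_eq h1 (isOpen_set_pi Set.finite_univ fun _ _ => isOpen_Ioo)
    hc.continuousOn continuousOn_const
  have h3 := h2 (x := 0) (fun _ _ => ⟨by simpa using Real.pi_pos, by simpa using Real.pi_pos⟩)
  rw [hφr]
  simpa [S.act_zero] using h3

end Trace

end GaugeSystem
end
end NCTorus

namespace NCTorus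

open scoped ContDiff

noncomputable section

namespace GaugeSystem

variable {n : ℕ} {A : Type*} [CStarAlgebra A] (S : GaugeSystem n A)

/-! ### Smooth elements and the canonical derivations -/

section Calculus

open NormedSpace

/-- The orbit map of `a` is smooth. -/
def IsSmooth (a : A) : Prop := ContDiff ℝ ∞ fun s : Fin n → ℝ => S.act s a

/-- The `j`-th canonical derivation. -/
def del (j : Fin n) (a : A) : A :=
  deriv (fun t : ℝ => S.act (Pi.single j (2 * Real.pi * t)) a) 0

variable {S}

namespace IsSmooth

theorem add {a b : A} (ha : S.IsSmooth a) (hb : S.IsSmooth b) : S.IsSmooth (a + b) := by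
  unfold IsSmooth
  simp_rw [map_add]
  exact ContDiff.add ha hb

theorem mul {a b : A} (ha : S.IsSmooth a) (hb : S.IsSmooth b) : S.IsSmooth (a * b) := by
  unfold IsSmooth
  simp_rw [map_mul]
  exact ContDiff.mul ha hb

theorem smul (c : ℂ) {a : A} (ha : S.IsSmooth a) : S.IsSmooth (c • a) := by
  unfold IsSmooth
  simp_rw [map_smul]
  exact ContDiff.const_smul c ha

theorem neg {a : A} (ha : S.IsSmooth a) : S.IsSmooth (-a) := by
  simpa using ha.smul (-1)

theorem sub {a b : A} (ha : S.IsSmooth a) (hb : S.IsSmooth b) : S.IsSmooth (a - b) := by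
  simpa only [sub_eq_add_neg] using ha.add hb.neg

theorem star {a : A} (ha : S.IsSmooth a) : S.IsSmooth (star a) := by
  unfold IsSmooth
  simp_rw [map_star]
  exact (starL' ℝ (A := A)).contDiff.comp ha

theorem zero : S.IsSmooth (0 : A) := by
  unfold IsSmooth
  simp_rw [map_zero]
  exact contDiff_const

theorem sum {ι : Type*} {s : Finset ι} {a : ι → A} (h : ∀ i ∈ s, S.IsSmooth (a i)) :
    S.IsSmooth (∑ i ∈ s, a i) :=
  Finset.sum_induction a S.IsSmooth (fun _ _ => add) zero h

end IsSmooth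

variable (S) in
theorem act_exp (s : Fin n → ℝ) (a : A) : S.act s (exp a) = exp (S.act s a) := by
  let _ : NormedAlgebra ℚ A := NormedAlgebra.restrictScalars ℚ ℂ A
  exact map_exp (S.act s) (S.actCLM s).continuous a

theorem IsSmooth.exp {a : A} (ha : S.IsSmooth a) : S.IsSmooth (exp a) := by
  unfold IsSmooth
  simp_rw [act_exp]
  exact contDiff_exp_real.comp ha

variable (S) in
/-- The action intertwines the derivative of the exponential function. -/
theorem act_fderiv_exp (s : Fin n → ℝ) (f h : A) :
    S.act s (fderiv ℝ exp f h) = fderiv ℝ exp (S.act s f) (S.act s h) := by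
  have hline : ∀ f h : A, HasDerivAt (fun t : ℝ => exp (f + t • h)) (fderiv ℝ exp f h) 0 := by
    intro f h
    have h1 : HasDerivAt (fun t : ℝ => f + t • h) h 0 := by
      simpa using ((hasDerivAt_id (0 : ℝ)).smul_const h).const_add f
    have h2 : HasFDerivAt exp (fderiv ℝ exp f) (f + (0 : ℝ) • h) := by
      simpa using (differentiable_exp_real f).hasFDerivAt
    exact h2.comp_hasDerivAt 0 h1
  have h1 := ((S.actCLM s).restrictScalars ℝ).hasFDerivAt.comp_hasDerivAt 0 (hline f h)
  refine h1.unique ?_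
  refine (hline (S.act s f) (S.act s h)).congr_of_eventuallyEq (Filter.Eventually.of_forall ?_)
  intro t
  change S.act s (NormedSpace.exp (f + t • h)) = _
  rw [act_exp, map_add, ← Complex.coe_smul, map_smul, Complex.coe_smul]

theorem IsSmooth.fderiv_exp {f h : A} (hf : S.IsSmooth f) (hh : S.IsSmooth h) :
    S.IsSmooth (fderiv ℝ NormedSpace.exp f h) := by
  unfold IsSmooth
  simp_rw [act_fderiv_exp]
  exact ((contDiff_exp_real.fderiv_right (by simp)).comp hf).clm_apply hh

/-- The product is -dexp_f(h), and dexp is smooth and equivariant under the action. -/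
theorem IsSmooth.psi_nabla {f h : A} (hf : S.IsSmooth f) (hh : S.IsSmooth h) :
    S.IsSmooth (NormedSpace.exp f * psi (nabla f) h) := by
  have := (hf.fderiv_exp hh).neg
  rwa [fderiv_exp_eq_psi, neg_neg] at this

theorem hasDerivAt_line (j : Fin n) (t : ℝ) :
    HasDerivAt (fun t : ℝ => (Pi.single j (2 * Real.pi * t) : Fin n → ℝ))
      (Pi.single j (2 * Real.pi)) t := by
  have h : (fun t : ℝ => (Pi.single j (2 * Real.pi * t) : Fin n → ℝ)) =
      fun t : ℝ => t • Pi.single j (2 * Real.pi) := by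
    funext t
    rw [← Pi.single_smul, smul_eq_mul, mul_comm]
  rw [h]
  simpa using (hasDerivAt_id t).smul_const (Pi.single j (2 * Real.pi) : Fin n → ℝ)

theorem IsSmooth.hasDerivAt {a : A} (ha : S.IsSmooth a) (j : Fin n) :
    HasDerivAt (fun t : ℝ => S.act (Pi.single j (2 * Real.pi * t)) a) (S.del j a) 0 :=
  DifferentiableAt.hasDerivAt
    (((ContDiff.differentiable ha (by simp)) _).comp 0 (hasDerivAt_line j 0).differentiableAt)

/-- By the group law, applying α_s to the orbit map translates it by s. This exhibits the orbit map
of ∂_j a as a partial derivative of that of a, which gives smoothness of ∂_j a. -/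
theorem IsSmooth.act_del {a : A} (ha : S.IsSmooth a) (j : Fin n) (s : Fin n → ℝ) :
    S.act s (S.del j a) = fderiv ℝ (fun s => S.act s a) s (Pi.single j (2 * Real.pi)) := by
  have h1 := ((S.actCLM s).restrictScalars ℝ).hasFDerivAt.comp_hasDerivAt 0 (ha.hasDerivAt j)
  refine h1.unique ?_
  have h2 : HasDerivAt (fun t : ℝ => s + Pi.single j (2 * Real.pi * t)) (Pi.single j (2 * Real.pi))
      (0 : ℝ) := (hasDerivAt_line j 0).const_add s
  have h3 : HasFDerivAt (fun s => S.act s a) (fderiv ℝ (fun s => S.act s a) s)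
      (s + Pi.single j (2 * Real.pi * 0)) := by
    simpa using (ContDiff.differentiable ha (by simp) s).hasFDerivAt
  refine (h3.comp_hasDerivAt (0 : ℝ) h2).congr_of_eventuallyEq (Filter.Eventually.of_forall ?_)
  intro t
  exact (S.act_add _ _ _).symm

theorem IsSmooth.del {a : A} (ha : S.IsSmooth a) (j : Fin n) : S.IsSmooth (S.del j a) := by
  unfold IsSmooth
  simp_rw [ha.act_del]
  exact (ContDiff.fderiv_right ha (by simp)).clm_apply contDiff_const

variable (S) in
theorem act_line_zero (j : Fin n) (a : A) : S.act (Pi.single j (2 * Real.pi * 0)) a = a := by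
  rw [mul_zero, Pi.single_zero, act_zero]

theorem del_mul {a b : A} (ha : S.IsSmooth a) (hb : S.IsSmooth b) (j : Fin n) :
    S.del j (a * b) = S.del j a * b + a * S.del j b := by
  have h := (ha.hasDerivAt j).mul (hb.hasDerivAt j)
  rw [act_line_zero, act_line_zero] at h
  refine ((ha.mul hb).hasDerivAt j).unique ?_
  simp_rw [map_mul]
  exact h

theorem del_add {a b : A} (ha : S.IsSmooth a) (hb : S.IsSmooth b) (j : Fin n) :
    S.del j (a + b) = S.del j a + S.del j b := by
  refine ((ha.add hb).hasDerivAt j).unique ?_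
  simp_rw [map_add]
  exact (ha.hasDerivAt j).add (hb.hasDerivAt j)

theorem del_smul (c : ℂ) {a : A} (ha : S.IsSmooth a) (j : Fin n) :
    S.del j (c • a) = c • S.del j a := by
  refine ((ha.smul c).hasDerivAt j).unique ?_
  simp_rw [map_smul]
  exact (ha.hasDerivAt j).const_smul c

theorem del_exp {a : A} (ha : S.IsSmooth a) (j : Fin n) :
    S.del j (exp a) = fderiv ℝ exp a (S.del j a) := by
  have h : HasFDerivAt exp (fderiv ℝ exp a) (S.act (Pi.single j (2 * Real.pi * 0)) a) := by
    rw [act_line_zero]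
    exact (differentiable_exp_real a).hasFDerivAt
  refine (ha.exp.hasDerivAt j).unique ?_
  simp_rw [act_exp]
  exact h.comp_hasDerivAt (0 : ℝ) (ha.hasDerivAt j)

theorem del_fderiv_exp {f h : A} (hf : S.IsSmooth f) (hh : S.IsSmooth h) (j : Fin n) :
    S.del j (fderiv ℝ exp f h) =
      expSnd f (S.del j f) h + fderiv ℝ exp f (S.del j h) := by
  have h1 := hasDerivAt_fderiv_exp (hf.hasDerivAt j) (hh.hasDerivAt j)
  rw [act_line_zero, act_line_zero] at h1
  refine ((hf.fderiv_exp hh).hasDerivAt j).unique ?_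
  simp_rw [act_fderiv_exp]
  exact h1

/-- The trace is constant along orbits. -/
theorem tr_del {a : A} (ha : S.IsSmooth a) (j : Fin n) : S.tr (S.del j a) = 0 := by
  have h := (S.tr.restrictScalars ℝ).hasFDerivAt.comp_hasDerivAt 0 (ha.hasDerivAt j)
  refine h.unique ?_
  refine (hasDerivAt_const (0 : ℝ) (S.tr a)).congr_of_eventuallyEq
    (Filter.Eventually.of_forall fun t => ?_)
  exact S.tr_act _ a

/-- Integration by parts. -/
theorem tr_del_mul {a b : A} (ha : S.IsSmooth a) (hb : S.IsSmooth b) (j : Fin n) :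
    S.tr (S.del j a * b) = -S.tr (a * S.del j b) := by
  rw [eq_neg_iff_add_eq_zero, ← map_add, ← del_mul ha hb, tr_del (ha.mul hb)]

theorem hasDerivAt_add_smul (f h : A) : HasDerivAt (fun t : ℝ => f + (t : ℂ) • h) h 0 := by
  simp_rw [Complex.coe_smul]
  simpa using ((hasDerivAt_id (0 : ℝ)).smul_const h).const_add f

theorem IsSmooth.add_smul {f h : A} (hf : S.IsSmooth f) (hh : S.IsSmooth h) (t : ℝ) :
    S.IsSmooth (f + (t : ℂ) • h) :=
  hf.add (hh.smul t)

theorem hasDerivAt_exp_add_smul (f h : A) :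
    HasDerivAt (fun t : ℝ => exp (f + (t : ℂ) • h)) (fderiv ℝ exp f h) 0 := by
  have h2 : HasFDerivAt exp (fderiv ℝ exp f) (f + ((0 : ℝ) : ℂ) • h) := by
    simpa using (differentiable_exp_real f).hasFDerivAt
  exact h2.comp_hasDerivAt (0 : ℝ) (hasDerivAt_add_smul f h)

theorem hasDerivAt_exp_neg_add_smul (f h : A) :
    HasDerivAt (fun t : ℝ => exp (-(f + (t : ℂ) • h))) (-fderiv ℝ exp (-f) h) 0 := by
  have h1 := hasDerivAt_exp_add_smul (-f) (-h)
  rw [map_neg] at h1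
  simpa only [neg_add, smul_neg] using h1

/-- Variation in `f` commutes with the derivations. -/
theorem hasDerivAt_del_exp {f h : A} (hf : S.IsSmooth f) (hh : S.IsSmooth h) (j : Fin n) :
    HasDerivAt (fun t : ℝ => S.del j (exp (f + (t : ℂ) • h))) (S.del j (fderiv ℝ exp f h)) 0 := by
  have h1 := hasDerivAt_fderiv_exp (hasDerivAt_add_smul f h)
    (hasDerivAt_add_smul (S.del j f) (S.del j h))
  simp only [Complex.ofReal_zero, zero_smul, add_zero] at h1
  -- The variation yields d²exp_f(h, ∂_j f), whereas ∂_j(dexp_f(h)) contains d²exp_f(∂_j f, h).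
  rw [expSnd_symm, ← del_fderiv_exp hf hh] at h1
  refine h1.congr_of_eventuallyEq (Filter.Eventually.of_forall fun t => ?_)
  change S.del j (NormedSpace.exp (f + (t : ℂ) • h)) = _
  rw [del_exp (hf.add_smul hh t), del_add hf (hh.smul t), del_smul _ hh]

variable (S) in
/-- The adjoint of the derivative of the exponential function with respect to the trace. -/
theorem tr_fderiv_exp_mul (f h x : A) :
    S.tr (fderiv ℝ exp f h * x) = -S.tr (h * (exp f * psi (nabla f) x)) := by
  set P : A →L[ℂ] ℂ := S.tr.comp (((ContinuousLinearMap.mul ℂ A).flip x).comp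
    (ContinuousLinearMap.mul ℂ A (exp f))) with hP
  set Q : A →L[ℂ] ℂ := S.tr.comp ((ContinuousLinearMap.mul ℂ A h).comp
    (ContinuousLinearMap.mul ℂ A (exp f))) with hQ
  have hPa : ∀ y, P y = S.tr (exp f * y * x) := fun _ => rfl
  have hQa : ∀ y, Q y = S.tr (h * (exp f * y)) := fun _ => rfl
  have hc : ∀ y : A, IntervalIntegrable (fun u : ℝ => exp (u • -f) * y * exp (u • f))
      MeasureTheory.volume 0 1 := fun y =>
    (((continuous_exp_real_smul _).mul continuous_const).mul
      (continuous_exp_real_smul _)).intervalIntegrable _ _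
  rw [fderiv_exp_apply, psi_nabla_apply, ← hPa, ← hQa, map_neg, neg_neg,
    ← P.intervalIntegral_comp_comm (hc h), ← Q.intervalIntegral_comp_comm (hc x)]
  -- Moving the exponentials cyclically around the trace replaces u by 1 - u, because e^f e^{-uf} =
  -- e^{(1-u)f}.
  have hreflect := intervalIntegral.integral_comp_sub_left (a := 0) (b := 1)
    (fun u : ℝ => Q (exp (u • -f) * x * exp (u • f))) 1
  rw [sub_self, sub_zero] at hreflect
  rw [← hreflect]
  refine intervalIntegral.integral_congr fun u _ => ?_
  change S.tr (exp f * (exp (u • -f) * h * exp (u • f)) * x) =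
    S.tr (h * (exp f * (exp ((1 - u) • -f) * x * exp ((1 - u) • f))))
  have hadd : ∀ v : ℝ, exp f * exp (v • -f) = exp ((1 - v) • f) := fun v => by
    let _ : NormedAlgebra ℚ A := NormedAlgebra.restrictScalars ℚ ℂ A
    rw [← exp_add_of_commute ((Commute.refl f).neg_right.smul_right v)]
    congr 1
    module
  calc S.tr (exp f * (exp (u • -f) * h * exp (u • f)) * x)
      = S.tr ((exp f * exp (u • -f)) * (h * exp (u • f) * x)) := by simp only [mul_assoc]
    _ = S.tr (h * exp (u • f) * x * exp ((1 - u) • f)) := by rw [hadd, S.tr_mul_comm]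
    _ = S.tr (h * ((exp f * exp ((1 - u) • -f)) * x * exp ((1 - u) • f))) := by
        rw [hadd, sub_sub_cancel]
        simp only [mul_assoc]
    _ = _ := by simp only [mul_assoc]

/-! ### The first variation and the gradient -/

variable (S) in
/-- The Einstein–Hilbert action of the conformally flat metric `e^f δ_{ij}`. -/
def einsteinHilbert (f : A) : ℂ :=
  (3 / 2 : ℂ) * ∑ i : Fin n, S.tr (S.del i (exp f) * exp (-f) * S.del i (exp f))

variable (S) in
/-- The `i`-th summand of the gradient of the Einstein–Hilbert action. -/
def gradTerm (f : A) (i : Fin n) : A :=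
  exp f * psi (nabla f) (S.del i (exp (-f) * S.del i (exp f)))
    + exp (-f) * psi (nabla (-f)) (S.del i (exp f) * S.del i (exp f))
    + exp f * psi (nabla f) (S.del i (S.del i (exp f) * exp (-f)))

theorem IsSmooth.gradTerm {f : A} (hf : S.IsSmooth f) (i : Fin n) : S.IsSmooth (S.gradTerm f i) :=
  ((hf.psi_nabla ((hf.neg.exp.mul (hf.exp.del i)).del i)).add
    (hf.neg.psi_nabla ((hf.exp.del i).mul (hf.exp.del i)))).add
    (hf.psi_nabla (((hf.exp.del i).mul hf.neg.exp).del i))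

theorem hasDerivAt_tr_summand {f h : A} (hf : S.IsSmooth f) (hh : S.IsSmooth h) (i : Fin n) :
    HasDerivAt (fun t : ℝ => S.tr (S.del i (exp (f + (t : ℂ) • h)) * exp (-(f + (t : ℂ) • h)) *
      S.del i (exp (f + (t : ℂ) • h)))) (S.tr (h * S.gradTerm f i)) 0 := by
  have h1 := hasDerivAt_del_exp hf hh i
  have h2 := hasDerivAt_exp_neg_add_smul f h
  have h3 := (S.tr.restrictScalars ℝ).hasFDerivAt.comp_hasDerivAt 0 ((h1.mul h2).mul h1)
  refine h3.congr_deriv ?_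
  set B := fderiv ℝ exp f h with hB
  have hBs : S.IsSmooth B := hf.fderiv_exp hh
  set D := S.del i (exp f) with hD
  have hDs : S.IsSmooth D := hf.exp.del i
  have hE : S.IsSmooth (exp (-f)) := hf.neg.exp
  simp only [Pi.mul_apply, Complex.ofReal_zero, zero_smul, add_zero,
    ContinuousLinearMap.coe_restrictScalars', ← hD]
  -- The minus sign from integration by parts cancels the one in `tr_fderiv_exp_mul`; in `e2` the
  -- sign of the variation of e^{-f} plays that role.
  have e1 : S.tr (S.del i B * exp (-f) * D) =
      S.tr (h * (exp f * psi (nabla f) (S.del i (exp (-f) * D)))) := by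
    rw [mul_assoc, tr_del_mul hBs (hE.mul hDs), hB, tr_fderiv_exp_mul, neg_neg]
  have e2 : S.tr (D * -fderiv ℝ exp (-f) h * D) =
      S.tr (h * (exp (-f) * psi (nabla (-f)) (D * D))) := by
    rw [S.tr_mul_comm, mul_neg, mul_neg, map_neg, ← mul_assoc, S.tr_mul_comm,
      tr_fderiv_exp_mul, neg_neg]
  have e3 : S.tr (D * exp (-f) * S.del i B) =
      S.tr (h * (exp f * psi (nabla f) (S.del i (D * exp (-f))))) := by
    rw [S.tr_mul_comm, tr_del_mul hBs (hDs.mul hE), hB, tr_fderiv_exp_mul, neg_neg]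
  rw [add_mul, map_add, map_add, e1, e2, e3, gradTerm, mul_add, mul_add, map_add, map_add]

/-- The first variation of the Einstein–Hilbert action. -/
theorem hasDerivAt_einsteinHilbert {f h : A} (hf : S.IsSmooth f) (hh : S.IsSmooth h) :
    HasDerivAt (fun t : ℝ => S.einsteinHilbert (f + (t : ℂ) • h))
      (S.tr (h * ((3 / 2 : ℂ) • ∑ i, S.gradTerm f i))) 0 := by
  have h1 := (HasDerivAt.fun_sum fun i (_ : i ∈ Finset.univ) =>
    hasDerivAt_tr_summand hf hh i).const_mul (3 / 2 : ℂ)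
  refine h1.congr_deriv ?_
  rw [mul_smul_comm, map_smul, Finset.mul_sum (a := h), map_sum, smul_eq_mul]

/-- An element is determined by its pairings with the self-adjoint smooth elements. -/
theorem IsSmooth.eq_zero {d : A} (hd : S.IsSmooth d)
    (h : ∀ a, S.IsSmooth a → IsSelfAdjoint a → S.tr (a * d) = 0) : d = 0 := by
  refine S.eq_zero_of_tr_star_mul_self ?_
  have h1 := h _ (hd.add hd.star) (IsSelfAdjoint.add_star_self d)
  -- Testing against d + d* and i(d - d*) gives τ(dd) + τ(d*d) = 0 and τ(dd) - τ(d*d) = 0; half the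
  -- difference is τ(d*d) = 0.
  have h2 := h (Complex.I • (d - Star.star d)) ((hd.sub hd.star).smul _) (by
    rw [IsSelfAdjoint, star_smul, star_sub, star_star, Complex.star_def, Complex.conj_I, neg_smul,
      ← smul_neg, neg_sub])
  rw [smul_mul_assoc, map_smul, smul_eq_zero_iff_right Complex.I_ne_zero, sub_mul, map_sub] at h2
  rw [add_mul, map_add] at h1
  linear_combination (h1 - h2) / 2

theorem gradient_iff {f : A} (hf : S.IsSmooth f) (G : A) :
    (S.IsSmooth G ∧ ∀ h, S.IsSmooth h → IsSelfAdjoint h →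
      HasDerivAt (fun t : ℝ => S.einsteinHilbert (f + (t : ℂ) • h)) (S.tr (h * G)) 0) ↔
      G = (3 / 2 : ℂ) • ∑ i, S.gradTerm f i := by
  have hG₀ : S.IsSmooth ((3 / 2 : ℂ) • ∑ i, S.gradTerm f i) :=
    (IsSmooth.sum fun i _ => hf.gradTerm i).smul _
  constructor
  · rintro ⟨hG, hd⟩
    rw [← sub_eq_zero]
    refine (hG.sub hG₀).eq_zero fun h hh hsa => ?_
    rw [mul_sub, map_sub, (hd h hh hsa).unique (hasDerivAt_einsteinHilbert hf hh), sub_self]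
  · rintro rfl
    exact ⟨hG₀, fun h hh _ => hasDerivAt_einsteinHilbert hf hh⟩

end Calculus

end GaugeSystem
end
end NCTorus

/-! ### Application to the noncommutative torus -/

namespace NCTorus

noncomputable section

/-- The noncommutative torus with its action and its trace. -/
def torusSystem {n : ℕ} (Θ : SkewMatrix n) : GaugeSystem n (Torus Θ) where
  act := action Θ
  act_add s t a := by
    refine toAmbient_injective Θ (BoundedContinuousFunction.ext fun ρ => ?_)
    rw [toAmbient_action, toAmbient_action, toAmbient_action]
    congr 1
    simp only [Rep.rotate, smul_smul, ← Complex.exp_add, Pi.add_apply, Complex.ofReal_add]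
    congr 2
    funext j
    ring_nf
  words := words Θ
  mem_unitary _ _ := words_mem_unitary
  act_word _ _ := action_word
  dense_span := dense_span_words Θ
  tr := traceCLM Θ
  tr_word _ _ := trace_word_of_ne_one
  word_eq_tr _ := word_of_degree_one_eq_trace
  -- Vector functionals in all representations suffice: each gives ‖aξ‖² = 0, and an element is zero
  -- if it acts as zero in every representation.
  separating a h := by
    refine eq_zero_of_evalRep fun ρ ξ => ?_
    have h1 := h (vectorFunctional ρ ξ) fun b =>
      ⟨_, sq_nonneg _, vectorFunctional_star_mul_self ρ ξ b⟩
    rw [vectorFunctional_star_mul_self] at h1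
    simpa using h1

end
end NCTorus

theorem mainTheorem10 (Θ : NCTorus.SkewMatrix 4) (f : NCTorus.Torus Θ)
    (hf : NCTorus.IsSmooth f) (hfs : IsSelfAdjoint f) (G : NCTorus.Torus Θ) :
    NCTorus.IsGradient f G ↔
      G = (3 / 2 : ℂ) • ∑ i : Fin 4,
        (NormedSpace.exp f * NCTorus.psi (NCTorus.nabla f)
            (NCTorus.del i (NormedSpace.exp (-f) * NCTorus.del i (NormedSpace.exp f)))
          + NormedSpace.exp (-f) * NCTorus.psi (NCTorus.nabla (-f))
            (NCTorus.del i (NormedSpace.exp f) * NCTorus.del i (NormedSpace.exp f))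
          + NormedSpace.exp f * NCTorus.psi (NCTorus.nabla f)
            (NCTorus.del i (NCTorus.del i (NormedSpace.exp f) * NormedSpace.exp (-f)))) := by
  -- Smoothness, derivations, trace and action functional of `torusSystem` unfold definitionally to
  -- those of the torus.
  exact Iff.trans ⟨fun h => ⟨h.smooth, h.hasDerivAt⟩, fun h => ⟨h.1, h.2⟩⟩
    (NCTorus.GaugeSystem.gradient_iff (S := NCTorus.torusSystem Θ) hf G)
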